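/- Let $V$ be a finite nonempty set of qudits of local dimension $d\ge 2$, $\mathcal H_V=\bigotimes_{v\in V}\mathbb C^d$. A noisy circuit of depth $L\ge 0$ is a composition $\mathcal N_V=\mathcal N_L\circ\cdots\circ\mathcal N_1$ in which each layer is $\mathcal N_\ell=\bigotimes_{e\in E_\ell}\mathcal N_{\ell,e}$ (identity on the vertices not covered), where $E_\ell$ is a set of pairwise disjoint subsets of $V$ and each $\mathcal N_{\ell,e}$ is a quantum channel (completely positive, trace preserving) on the qudits in $e$. For a channel $\Phi$ on $V$ and $A\subseteq V$, the light-cone of $A$ under $\Phi$ is a smallest (minimum cardinality) set $S\subseteq V$ such that every self-adjoint $O$ with $\operatorname{tr}_A O=0$ satisfies $\operatorname{tr}_S\Phi(O)=0$. Let $I_{\mathcal N_V}$ be the maximum over $v\in V$ of the cardinality of the light-cone of $\{v\}$ under $\mathcal N_V$, and, for $e\in E_\ell$, let $I(e,L-\ell)$ be the cardinality of the light-cone of $e$ under the circuit $\mathcal N_L\circ\cdots\circ\mathcal N_{\ell+1}$ formed by the last $L-\ell$ layers (the identity if $\ell=L$). For self-adjoint $O$ on $\mathcal H_V$ and a state $\sigma$,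 put $\operatorname{Var}_\sigma(O)=\operatorname{tr}\big[\sigma\,|O-\operatorname{tr}[\sigma O]\,\mathbb I|^2\big]$ and $\|O\|_L=2\max_{v\in V}\min_{K}\|O-K\otimes\mathbb I_v\|_\infty$, where $K$ ranges over the self-adjoint operators on $\mathcal H_{V\setminus\{v\}}$ and $\|\cdot\|_\infty$ is the operator norm. The state $\sigma$ satisfies a $(2,\infty)$-Poincaré inequality with constant $C>0$ if $\operatorname{Var}_\sigma(O)\le C\,|V|\,\|O\|_L^2$ for every self-adjoint $O$. **Proposition.** For every product input state $\rho=\bigotimes_{v\in V}\rho_v$, the output $\mathcal N_V(\rho)$ satisfies a $(2,\infty)$-Poincaré inequality with a constant $$C\le 4\Big(I_{\mathcal N_V}^2+\frac{\max_\ell|E_\ell|}{|V|}\sum_{\ell=1}^L\max_{e\in E_\ell}I(e,L-\ell)^2\Big),$$ where a maximum over an empty set is $0$. -/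

import Mathlib

open scoped Kronecker Matrix ComplexOrder

/-- Operators on the Hilbert space of `d`-dimensional qudits labelled by the finite set `W`,
written as matrices in the computational basis `W → Fin d`. -/
abbrev QOp (W : Type*) (d : ℕ) : Type _ := Matrix (W → Fin d) (W → Fin d) ℂ

/-- Quantum states (density matrices). -/
def IsQState {ι : Type*} [Fintype ι] (ρ : Matrix ι ι ℂ) : Prop :=
  ρ.PosSemidef ∧ ρ.trace = 1

/-- The operator norm (largest singular value) of a matrix. -/
noncomputable def qOpNorm {ι : Type*} [Fintype ι] [DecidableEq ι] (X : Matrix ι ι ℂ) : ℝ :=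
  ‖Matrix.toEuclideanCLM (n := ι) (𝕜 := ℂ) X‖

/-- `Φ ⊗ id` on operators on the tensor product of two systems with basis sets `ι` and `κ`. -/
def amplify {ι : Type*} (κ : Type*) (Φ : Matrix ι ι ℂ →ₗ[ℂ] Matrix ι ι ℂ) :
    Matrix (ι × κ) (ι × κ) ℂ →ₗ[ℂ] Matrix (ι × κ) (ι × κ) ℂ where
  toFun X := Matrix.of fun p q => Φ (Matrix.of fun i j => X (i, p.2) (j, q.2)) p.1 q.1
  map_add' X Y := by
    ext p q
    exact congrFun (congrFun (Φ.map_add (Matrix.of fun i j => X (i, p.2) (j, q.2))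
      (Matrix.of fun i j => Y (i, p.2) (j, q.2))) p.1) q.1
  map_smul' c X := by
    ext p q
    exact congrFun (congrFun (Φ.map_smul c (Matrix.of fun i j => X (i, p.2) (j, q.2))) p.1) q.1

/-- Quantum channels: completely positive trace-preserving linear maps. -/
structure IsQChannel {ι : Type*} [Fintype ι] (Φ : Matrix ι ι ℂ →ₗ[ℂ] Matrix ι ι ℂ) : Prop where
  completelyPositive : ∀ (n : ℕ) (X : Matrix (ι × Fin n) (ι × Fin n) ℂ),
    X.PosSemidef → (amplify (Fin n) Φ X).PosSemidef
  tracePreserving : ∀ X : Matrix ι ι ℂ, (Φ X).trace = X.trace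

section Subsystems

variable {V : Type*} [DecidableEq V] {d : ℕ}

/-- Splitting a computational basis label of `V` into its parts on `A` and on `V ∖ A`. -/
def splitBasis (A : Finset V) (d : ℕ) :
    (V → Fin d) ≃ ({v // v ∈ A} → Fin d) × ({v // v ∉ A} → Fin d) :=
  Equiv.piEquivPiSubtypeProd (fun v => v ∈ A) (fun _ => Fin d)

/-- The partial trace `tr_A` over the qudits in `A`. -/
def partialTrace (A : Finset V) (X : QOp V d) : QOp {v // v ∉ A} d :=
  Matrix.of fun x y => ∑ a : {v // v ∈ A} → Fin d,
    X ((splitBasis A d).symm (a, x)) ((splitBasis A d).symm (a, y))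

/-- The operator `𝕀_A ⊗ K` on `V`, for an operator `K` on `V ∖ A`. -/
def tensorOne (A : Finset V) (K : QOp {v // v ∉ A} d) : QOp V d :=
  Matrix.reindex (splitBasis A d).symm (splitBasis A d).symm
    ((1 : QOp {v // v ∈ A} d) ⊗ₖ K)

/-- The map `Φ ⊗ id_{V ∖ A}` on operators on `V`, for a map `Φ` on operators on `A`. -/
def extendMap (A : Finset V) (Φ : QOp {v // v ∈ A} d →ₗ[ℂ] QOp {v // v ∈ A} d) :
    Module.End ℂ (QOp V d) :=
  (Matrix.reindexLinearEquiv ℂ ℂ (splitBasis A d) (splitBasis A d)).symm.toLinearMap ∘ₗ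
    amplify ({v // v ∉ A} → Fin d) Φ ∘ₗ
    (Matrix.reindexLinearEquiv ℂ ℂ (splitBasis A d) (splitBasis A d)).toLinearMap

/-- Replace the part on `A` of the basis label `x` by `a`. -/
def overwrite (A : Finset V) (a : {v // v ∈ A} → Fin d) (x : V → Fin d) : V → Fin d :=
  fun v => if h : v ∈ A then a ⟨v, h⟩ else x v

theorem extendMap_apply (A : Finset V) (Φ : QOp {v // v ∈ A} d →ₗ[ℂ] QOp {v // v ∈ A} d)
    (X : QOp V d) (x y : V → Fin d) :
    extendMap A Φ X x y =
      Φ (Matrix.of fun a b => X (overwrite A a x) (overwrite A b y))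
        (fun v => x v.1) (fun v => y v.1) := rfl

theorem linearMap_entry_eq_sum {ι : Type*} [Fintype ι] [DecidableEq ι]
    (Φ : Matrix ι ι ℂ →ₗ[ℂ] Matrix ι ι ℂ) (M : Matrix ι ι ℂ) (i j : ι) :
    Φ M i j = ∑ a, ∑ b, M a b * Φ (Matrix.single a b 1) i j := by
  conv_lhs => rw [Matrix.matrix_eq_sum_single M]
  simp only [map_sum, Matrix.sum_apply]
  refine Finset.sum_congr rfl fun a _ => Finset.sum_congr rfl fun b _ => ?_
  have h : Matrix.single a b (M a b) = M a b • Matrix.single a b (1 : ℂ) := by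
    simp [Matrix.smul_single]
  rw [h, map_smul]
  simp

/-- Maps acting on disjoint sets of qudits commute. -/
theorem extendMap_commute {A B : Finset V} (hAB : Disjoint A B)
    (Φ : QOp {v // v ∈ A} d →ₗ[ℂ] QOp {v // v ∈ A} d)
    (Ψ : QOp {v // v ∈ B} d →ₗ[ℂ] QOp {v // v ∈ B} d) :
    Commute (extendMap A Φ) (extendMap B Ψ) := by
  have key : ∀ (A B : Finset V) (_ : Disjoint A B) (a : {v // v ∈ A} → Fin d) (x : V → Fin d),
      (fun v : {v // v ∈ B} => overwrite A a x v.1) = fun v => x v.1 := by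
    intro A B h a x
    funext v
    have hv : v.1 ∉ A := fun hA => Finset.disjoint_left.1 h hA v.2
    simp [overwrite, hv]
  have swap : ∀ (a : {v // v ∈ A} → Fin d) (b : {v // v ∈ B} → Fin d) (x : V → Fin d),
      overwrite B b (overwrite A a x) = overwrite A a (overwrite B b x) := by
    intro a b x
    funext v
    by_cases hA : v ∈ A
    · have hB : v ∉ B := fun hB => Finset.disjoint_left.1 hAB hA hB
      simp [overwrite, hA, hB]
    · by_cases hB : v ∈ B <;> simp [overwrite, hA, hB]
  refine LinearMap.ext fun X => ?_
  ext x y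
  simp only [Module.End.mul_apply]
  simp only [extendMap_apply, key A B hAB, key B A hAB.symm]
  rw [linearMap_entry_eq_sum Φ, linearMap_entry_eq_sum Ψ]
  simp only [Matrix.of_apply]
  have h1 : ∀ (a a' : {v // v ∈ A} → Fin d), Ψ (Matrix.of fun b b' =>
      X (overwrite B b (overwrite A a x)) (overwrite B b' (overwrite A a' y)))
        (fun v => x v.1) (fun v => y v.1) = ∑ b, ∑ b',
      X (overwrite B b (overwrite A a x)) (overwrite B b' (overwrite A a' y)) *
        Ψ (Matrix.single b b' 1) (fun v => x v.1) (fun v => y v.1) := by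
    intro a a'
    rw [linearMap_entry_eq_sum Ψ]
    rfl
  have h2 : ∀ (b b' : {v // v ∈ B} → Fin d), Φ (Matrix.of fun a a' =>
      X (overwrite A a (overwrite B b x)) (overwrite A a' (overwrite B b' y)))
        (fun v => x v.1) (fun v => y v.1) = ∑ a, ∑ a',
      X (overwrite B b (overwrite A a x)) (overwrite B b' (overwrite A a' y)) *
        Φ (Matrix.single a a' 1) (fun v => x v.1) (fun v => y v.1) := by
    intro b b'
    rw [linearMap_entry_eq_sum Φ]
    simp only [Matrix.of_apply, swap]
  simp only [h1, h2, Finset.sum_mul]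
  simp only [← Fintype.sum_prod_type']
  refine Fintype.sum_equiv
    { toFun := fun p => (p.2.2.1, p.2.2.2, p.1, p.2.1)
      invFun := fun p => (p.2.2.1, p.2.2.2, p.1, p.2.1)
      left_inv := fun _ => rfl
      right_inv := fun _ => rfl } _ _ fun p => ?_
  exact mul_right_comm _ _ _

end Subsystems

section Circuits

/-- One layer of a noisy circuit: a set `E` of pairwise disjoint subsets of vertices, and on each
of them a quantum channel. The values of `gate` outside `E` play no role. -/
structure CircuitLayer (V : Type*) [DecidableEq V] (d : ℕ) where
  E : Finset (Finset V)
  disjoint : (E : Set (Finset V)).PairwiseDisjoint id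
  gate : (e : Finset V) → QOp {v // v ∈ e} d →ₗ[ℂ] QOp {v // v ∈ e} d
  isChannel : ∀ e ∈ E, IsQChannel (gate e)

variable {V : Type*} [DecidableEq V] {d : ℕ}

/-- The tensor product of the gates of a layer: the product of the (commuting) maps
`gate e ⊗ id_{V ∖ e}`, `e ∈ E`. -/
noncomputable def CircuitLayer.toMap (N : CircuitLayer V d) : Module.End ℂ (QOp V d) :=
  N.E.noncommProd (fun e => extendMap e (N.gate e)) fun _ he _ hf hef =>
    extendMap_commute (N.disjoint he hf hef) _ _

/-- The channel implemented by a circuit, given by its list of layers, the first layer of the list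
being applied first. -/
noncomputable def circuitMap : List (CircuitLayer V d) → Module.End ℂ (QOp V d)
  | [] => LinearMap.id
  | N :: c => circuitMap c ∘ₗ N.toMap

/-- `S` confines the influence of the qudits in `A` under the map `Φ`: every observable `O` with
`tr_A O = 0` satisfies `tr_S Φ(O) = 0`. -/
def ConfinesInfluence (Φ : Module.End ℂ (QOp V d)) (A S : Finset V) : Prop :=
  ∀ O : QOp V d, O.IsHermitian → partialTrace A O = 0 → partialTrace S (Φ O) = 0

/-- The number of vertices of the light-cone of `A` under `Φ`, i.e. of a smallest set that confines
the influence of the qudits in `A`. -/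
noncomputable def lightConeSize (Φ : Module.End ℂ (QOp V d)) (A : Finset V) : ℕ :=
  sInf {k | ∃ S : Finset V, S.card = k ∧ ConfinesInfluence Φ A S}

/-- The light-cone of a map: the maximal light-cone size of a single vertex. -/
noncomputable def maxLightCone [Fintype V] (Φ : Module.End ℂ (QOp V d)) : ℕ :=
  Finset.univ.sup fun v : V => lightConeSize Φ {v}

/-- The maximal number of gates in a layer. -/
def maxGates (c : List (CircuitLayer V d)) : ℕ :=
  Finset.univ.sup fun l : Fin c.length => (c.get l).E.card

/-- For the layer `l` (numbered from `0`), the maximum over its gates `e` of the size of the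
light-cone of `e` for the circuit made of the layers that come after `l`. -/
noncomputable def maxGateLightCone (c : List (CircuitLayer V d)) (l : Fin c.length) : ℕ :=
  (c.get l).E.sup fun e => lightConeSize (circuitMap (c.drop (l.val + 1))) e

end Circuits

section Poincare

variable {V : Type*} [Fintype V] [DecidableEq V] {d : ℕ}

/-- The tensor product `⊗_v ρ_v` of one-qudit operators. -/
def productOp (ρ : V → Matrix (Fin d) (Fin d) ℂ) : QOp V d :=
  Matrix.of fun x y => ∏ v, ρ v (x v) (y v)

/-- The variance `tr[ω |O - tr[ω O] 𝕀|²]`. -/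
noncomputable def qVariance (ω O : QOp V d) : ℝ :=
  (ω * ((O - (ω * O).trace • (1 : QOp V d))ᴴ * (O - (ω * O).trace • (1 : QOp V d)))).trace.re

/-- The quantum Lipschitz constant `2 max_v min_K ‖H - K ⊗ 𝕀_v‖`, where `K` ranges over the
self-adjoint operators on `V ∖ {v}`. -/
noncomputable def qLipschitz (H : QOp V d) : ℝ :=
  2 * ⨆ v : V, ⨅ K : {K : QOp {w // w ∉ ({v} : Finset V)} d // K.IsHermitian},
    qOpNorm (H - tensorOne {v} K.1)

/-- The `(2,∞)`-Poincaré inequality with constant `C > 0`. -/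
def PoincareTwoInfty (σ : QOp V d) (C : ℝ) : Prop :=
  0 < C ∧ ∀ O : QOp V d, O.IsHermitian →
    qVariance σ O ≤ C * (Fintype.card V : ℝ) * qLipschitz O ^ 2

end Poincare

/-! The argument tracks second moments in the Heisenberg picture. Let a channel `T` act on the
qudits of `A`, and let `G = D + K` with `K` trivial on `A` and `-r ≤ D ≤ r`. The dual `T*` is a
bimodule map over the operators trivial on `A`, so in `tr[T(σ)G²] - tr[σ T*(G)²]` every term
containing `K` cancels. What remains is `tr[T(σ)D²] - tr[σ T*(D)²] ≤ r²`
(`extendMap_second_moment_le`).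

The gates are peeled off one at a time. For a gate `e`, `G` is the observable `O` pulled back
through the later layers `Φ`; the other gates of the same layer act elsewhere and do no harm. If `S`
is the light-cone of `e`, then `Φ` sends Hermitian elements of `ker tr_e` into `ker tr_S`, so dually
`Φ*` sends operators trivial on `S` to operators trivial on `e`. Depolarizing the qudits of `S`
successively shows that `O` is within `|S| ‖O‖_L` of an operator trivial on `S`. Each gate therefore
costs at most `(|S| ‖O‖_L)²` (`circuitMap_second_moment_le`).

The product input is treated as one more layer, which resets each qudit `v` to `ρ v`. It fixes the
input state, and its dual turns every observable into a scalar, so the second moment left at the end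
is the squared mean and the accumulated cost bounds the variance. Its `|V|` one-qudit gates
contribute the term `|V| I²`. -/

set_option linter.unusedSectionVars false


/-! ### Trace duality and positive trace-preserving maps -/

section TracePairing

variable {ι : Type*} [Fintype ι]

open scoped MatrixOrder in
theorem Matrix.PosSemidef.trace_mul_nonneg {A B : Matrix ι ι ℂ} (hA : A.PosSemidef)
    (hB : B.PosSemidef) : 0 ≤ (A * B).trace := by
  classical
  obtain ⟨X, rfl⟩ := CStarAlgebra.nonneg_iff_eq_star_mul_self.1 hB.nonneg
  rw [Matrix.star_eq_conjTranspose, ← Matrix.mul_assoc, Matrix.trace_mul_comm, ← Matrix.mul_assoc]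
  exact (hA.mul_mul_conjTranspose_same X).trace_nonneg

/-- The positive semidefinite cone is self-dual: testing against rank-one matrices recovers the
quadratic form. -/
theorem posSemidef_of_trace_mul_nonneg {A : Matrix ι ι ℂ}
    (h : ∀ X : Matrix ι ι ℂ, X.PosSemidef → 0 ≤ (A * X).trace) : A.PosSemidef := by
  classical
  have key : ∀ x : ι → ℂ, 0 ≤ star x ⬝ᵥ A *ᵥ x := by
    intro x
    have := h _ (Matrix.posSemidef_vecMulVec_self_star x)
    rwa [Matrix.mul_vecMulVec, Matrix.trace_vecMulVec, dotProduct_comm] at this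
  rw [← Matrix.isPositive_toEuclideanLin_iff, LinearMap.isPositive_iff_complex]
  intro x
  have h2 : inner ℂ (A.toEuclideanLin x) x = star (star x.ofLp ⬝ᵥ A *ᵥ x.ofLp) := by
    rw [EuclideanSpace.inner_eq_star_dotProduct, Matrix.star_dotProduct, star_star,
      dotProduct_comm]
    rfl
  rw [h2, IsSelfAdjoint.of_nonneg (key x)]
  obtain ⟨h3, h4⟩ := Complex.nonneg_iff.1 (key x)
  refine ⟨Complex.ext rfl h4, h3⟩

variable [DecidableEq ι]

/-- The adjoint of a linear map on matrices for the bilinear pairing `tr[A B]`. -/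
noncomputable def heisenberg (Φ : Module.End ℂ (Matrix ι ι ℂ)) : Module.End ℂ (Matrix ι ι ℂ) where
  toFun O := Matrix.of fun i j => (O * Φ (Matrix.single j i 1)).trace
  map_add' X Y := by ext; simp [Matrix.add_mul]
  map_smul' c X := by ext; simp

theorem trace_heisenberg_mul (Φ : Module.End ℂ (Matrix ι ι ℂ)) (O X : Matrix ι ι ℂ) :
    (heisenberg Φ O * X).trace = (O * Φ X).trace := by
  conv_rhs => rw [Matrix.matrix_eq_sum_single X]
  have h : ∀ i j, Matrix.single i j (X i j) = X i j • Matrix.single i j (1 : ℂ) := by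
    intro i j
    simp [Matrix.smul_single]
  simp only [h, map_sum, map_smul, Matrix.mul_sum, Matrix.trace_sum, Matrix.mul_smul,
    Matrix.trace_smul]
  rw [Finset.sum_comm]
  simp [heisenberg, Matrix.trace, Matrix.mul_apply, mul_comm]

theorem heisenberg_comp (Φ Ψ : Module.End ℂ (Matrix ι ι ℂ)) (O : Matrix ι ι ℂ) :
    heisenberg (Φ ∘ₗ Ψ) O = heisenberg Ψ (heisenberg Φ O) := by
  rw [Matrix.ext_iff_trace_mul_right]
  intro X
  simp [trace_heisenberg_mul]

theorem heisenberg_id (O : Matrix ι ι ℂ) :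
    heisenberg LinearMap.id O = O := by
  rw [Matrix.ext_iff_trace_mul_right]
  intro X
  simp [trace_heisenberg_mul]

/-- Positive trace-preserving maps. -/
structure IsPTP {ι : Type*} [Fintype ι] (Φ : Module.End ℂ (Matrix ι ι ℂ)) : Prop where
  pos : ∀ X : Matrix ι ι ℂ, X.PosSemidef → (Φ X).PosSemidef
  trace : ∀ X : Matrix ι ι ℂ, (Φ X).trace = X.trace

theorem IsPTP.id : IsPTP (LinearMap.id : Module.End ℂ (Matrix ι ι ℂ)) :=
  ⟨fun _ h => h, fun _ => rfl⟩

theorem IsPTP.comp {Φ Ψ : Module.End ℂ (Matrix ι ι ℂ)} (hΦ : IsPTP Φ) (hΨ : IsPTP Ψ) :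
    IsPTP (Φ ∘ₗ Ψ) :=
  ⟨fun X h => hΦ.pos _ (hΨ.pos X h), fun X => (hΦ.trace _).trans (hΨ.trace X)⟩

theorem IsPTP.isQState {Φ : Module.End ℂ (Matrix ι ι ℂ)} (hΦ : IsPTP Φ) {σ : Matrix ι ι ℂ}
    (hσ : IsQState σ) : IsQState (Φ σ) :=
  ⟨hΦ.pos _ hσ.1, (hΦ.trace _).trans hσ.2⟩

theorem IsPTP.heisenberg_one {Φ : Module.End ℂ (Matrix ι ι ℂ)} (hΦ : IsPTP Φ) :
    heisenberg Φ 1 = 1 := by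
  rw [Matrix.ext_iff_trace_mul_right]
  intro X
  simp [trace_heisenberg_mul, hΦ.trace]

theorem IsPTP.heisenberg_pos {Φ : Module.End ℂ (Matrix ι ι ℂ)} (hΦ : IsPTP Φ)
    {O : Matrix ι ι ℂ} (hO : O.PosSemidef) : (heisenberg Φ O).PosSemidef :=
  posSemidef_of_trace_mul_nonneg fun X hX => by
    rw [trace_heisenberg_mul]
    exact hO.trace_mul_nonneg (hΦ.pos X hX)

end TracePairing

/-! ### Two-sided Loewner bounds -/

section OpBound

variable {ι : Type*} [Fintype ι] [DecidableEq ι]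

/-- `-r ≤ H ≤ r` in the Loewner order. -/
def OpBound (H : Matrix ι ι ℂ) (r : ℝ) : Prop :=
  ((r : ℂ) • (1 : Matrix ι ι ℂ) - H).PosSemidef ∧ ((r : ℂ) • (1 : Matrix ι ι ℂ) + H).PosSemidef

theorem OpBound.isHermitian {H : Matrix ι ι ℂ} {r : ℝ} (h : OpBound H r) : H.IsHermitian := by
  have h2 : ((r : ℂ) • (1 : Matrix ι ι ℂ)).IsHermitian := by
    rw [Matrix.IsHermitian, Matrix.conjTranspose_smul]; simp
  have := h.2.1.sub h2
  simpa using this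

theorem OpBound.neg {H : Matrix ι ι ℂ} {r : ℝ} (h : OpBound H r) : OpBound (-H) r := by
  refine ⟨by simpa using h.2, by simpa [sub_eq_add_neg] using h.1⟩

theorem OpBound.add {H K : Matrix ι ι ℂ} {r s : ℝ} (h : OpBound H r) (k : OpBound K s) :
    OpBound (H + K) (r + s) := by
  refine ⟨?_, ?_⟩
  · convert h.1.add k.1 using 1
    push_cast; rw [add_smul]; abel
  · convert h.2.add k.2 using 1
    push_cast; rw [add_smul]; abel

theorem OpBound.sub {H K : Matrix ι ι ℂ} {r s : ℝ} (h : OpBound H r) (k : OpBound K s) :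
    OpBound (H - K) (r + s) := by
  rw [sub_eq_add_neg]; exact h.add k.neg

theorem OpBound.mono {H : Matrix ι ι ℂ} {r s : ℝ} (h : OpBound H r) (hrs : r ≤ s) :
    OpBound H s := by
  have h0 : OpBound (0 : Matrix ι ι ℂ) (s - r) := by
    have : (((s - r : ℝ) : ℂ) • (1 : Matrix ι ι ℂ)).PosSemidef :=
      Matrix.PosSemidef.one.smul (by exact_mod_cast sub_nonneg.2 hrs)
    exact ⟨by simpa using this, by simpa using this⟩
  simpa using h.add h0

theorem opBound_zero : OpBound (0 : Matrix ι ι ℂ) 0 := by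
  refine ⟨by simpa using Matrix.PosSemidef.zero, by simpa using Matrix.PosSemidef.zero⟩

/-- The reason for using order bounds in place of norms: positive unital maps preserve them at once.
-/
theorem OpBound.map {Φ : Module.End ℂ (Matrix ι ι ℂ)}
    (hpos : ∀ X : Matrix ι ι ℂ, X.PosSemidef → (Φ X).PosSemidef) (hone : Φ 1 = 1)
    {H : Matrix ι ι ℂ} {r : ℝ} (h : OpBound H r) : OpBound (Φ H) r := by
  refine ⟨?_, ?_⟩
  · simpa [hone] using hpos _ h.1
  · simpa [hone] using hpos _ h.2

open scoped MatrixOrder Matrix.Norms.L2Operator in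
theorem opBound_qOpNorm {H : Matrix ι ι ℂ} (hH : H.IsHermitian) : OpBound H (qOpNorm H) := by
  have h1 := IsSelfAdjoint.le_algebraMap_norm_self (a := H) hH
  have h2 := IsSelfAdjoint.neg_algebraMap_norm_le_self (a := H) hH
  have h3 : algebraMap ℝ (Matrix ι ι ℂ) ‖H‖ = (qOpNorm H : ℂ) • 1 := by
    rw [Algebra.algebraMap_eq_smul_one, qOpNorm, ← Matrix.cstar_norm_def]
    ext; simp
  rw [Matrix.le_iff, h3] at h1 h2
  exact ⟨h1, by simpa [add_comm] using h2⟩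

theorem opBound_of_forall_pos {H : Matrix ι ι ℂ} {r : ℝ}
    (h : ∀ ε : ℝ, 0 < ε → OpBound H (r + ε)) : OpBound H r := by
  have key : ∀ K : Matrix ι ι ℂ,
      (∀ ε : ℝ, 0 < ε → (((r + ε : ℝ) : ℂ) • (1 : Matrix ι ι ℂ) + K).PosSemidef) →
        ((r : ℂ) • (1 : Matrix ι ι ℂ) + K).PosSemidef := by
    intro K hK
    refine posSemidef_of_trace_mul_nonneg fun X hX => ?_
    have h := fun ε hε => (hK ε hε).trace_mul_nonneg hX
    have e : ∀ ε : ℝ, ((((r + ε : ℝ) : ℂ) • (1 : Matrix ι ι ℂ) + K) * X).trace =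
       ((((r : ℝ) : ℂ) • (1 : Matrix ι ι ℂ) + K) * X).trace + ε * X.trace := by
      intro ε
      simp [Matrix.add_mul]; ring
    obtain ⟨t0, t1⟩ := Complex.nonneg_iff.1 hX.trace_nonneg
    simp only [e, Complex.nonneg_iff] at h ⊢
    simp only [Complex.add_re, Complex.add_im, Complex.re_ofReal_mul, Complex.im_ofReal_mul, ← t1] at h
    refine ⟨?_, by simpa using (h 1 one_pos).2⟩
    refine le_of_forall_pos_le_add fun ε hε => ?_
    -- The scaling makes the error at most `ε` after multiplication by `tr X`; the `+ 1` covers `tr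
    -- X = 0`.
    have h5 := (h (ε / (X.trace.re + 1)) (by positivity)).1
    refine h5.trans ?_
    gcongr
    rw [div_mul_eq_mul_div, div_le_iff₀ (by positivity)]
    nlinarith
  refine ⟨?_, key H fun ε hε => (h ε hε).2⟩
  rw [sub_eq_add_neg]
  exact key (-H) fun ε hε => by simpa [sub_eq_add_neg] using (h ε hε).1

open scoped MatrixOrder in
/-- A bounded observable has bounded second moment in every state. -/
theorem OpBound.trace_sq_le {H σ : Matrix ι ι ℂ} {r : ℝ} (h : OpBound H r) (hσ : IsQState σ) :
    (σ * (H * H)).trace.re ≤ r ^ 2 := by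
  have hr : 0 ≤ r := by
    have h1 := (Complex.nonneg_iff.1 (hσ.1.trace_mul_nonneg h.1)).1
    have h2 := (Complex.nonneg_iff.1 (hσ.1.trace_mul_nonneg h.2)).1
    simp [Matrix.mul_sub, Matrix.mul_add, hσ.2] at h1 h2
    linarith
  -- The identity used for `r > 0` yields the bound only after division by `2r`.
  rcases hr.eq_or_lt with rfl | hr
  · have h1 : H ≤ 0 := by rw [Matrix.le_iff]; simpa using h.1
    have h2 : 0 ≤ H := by rw [Matrix.le_iff]; simpa using h.2
    simp [le_antisymm h1 h2]
  · have e : ∀ A : Matrix ι ι ℂ, A * ((r : ℂ) • 1 - H) * (A * ((r : ℂ) • 1 + H)) = 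
      A * ((r : ℂ) • 1 - H) * (A * ((r : ℂ) • 1 + H)) := fun _ => rfl
    have h1 := h.1.mul_mul_conjTranspose_same ((r : ℂ) • (1 : Matrix ι ι ℂ) + H)
    have h2 := h.2.mul_mul_conjTranspose_same ((r : ℂ) • (1 : Matrix ι ι ℂ) - H)
    rw [h.1.1] at h2
    rw [h.2.1] at h1
    have h3 := (Complex.nonneg_iff.1 (hσ.1.trace_mul_nonneg (h1.add h2))).1
    -- Both summands on the left are positive, being conjugates of `r - H` and `r + H`, so `r² - H²`
    -- has nonnegative expectation.
    have e : ((r : ℂ) • 1 + H) * ((r : ℂ) • 1 - H) * ((r : ℂ) • 1 + H)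
        + ((r : ℂ) • 1 - H) * ((r : ℂ) • 1 + H) * ((r : ℂ) • 1 - H)
        = (2 * r : ℂ) • ((r ^ 2 : ℂ) • (1 : Matrix ι ι ℂ) - H * H) := by
      have c : Commute ((r : ℂ) • (1 : Matrix ι ι ℂ)) H := by
        rw [Commute, SemiconjBy]; simp
      have e3 : (2 * r : ℂ) • ((r ^ 2 : ℂ) • (1 : Matrix ι ι ℂ) - H * H) =
         2 * ((r : ℂ) • (1 : Matrix ι ι ℂ)) * (((r : ℂ) • (1 : Matrix ι ι ℂ)) ^ 2 - H * H) := by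
        rw [smul_pow, one_pow, mul_smul_comm, mul_one, smul_mul_assoc, mul_smul, two_mul,
          two_smul]
        simp
      rw [e3]
      have := c.eq
      generalize (r : ℂ) • (1 : Matrix ι ι ℂ) = R at *
      have e5 : (R + H) * (R - H) = R * R - H * H := by
        rw [add_mul, mul_sub, mul_sub, this]; abel
      have e6 : (R - H) * (R + H) = R * R - H * H := by
        rw [sub_mul, mul_add, mul_add, this]; abel
      rw [e5, mul_assoc (R - H), ← e5, ← mul_assoc, e6, e5, ← mul_add, sq]
      have c2 : Commute (R * R - H * H) R := by
        refine ((Commute.refl R).mul_left (Commute.refl R)).sub_left ?_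
        exact Commute.mul_left c.symm c.symm
      rw [add_add_sub_cancel, mul_add, c2.eq, mul_assoc, two_mul]
    rw [e] at h3
    simp [Matrix.mul_sub, hσ.2, ← Complex.ofReal_pow] at h3
    nlinarith

end OpBound

/-! ### Amplified maps and replacement channels -/

section Amplify

variable {ι κ : Type*} [Fintype ι] [Fintype κ] [DecidableEq ι] [DecidableEq κ]

/-- Source of the bimodule property: operators on the second factor only form linear combinations of
the blocks to which `Φ` is applied. -/
theorem amplify_kronecker_mul (Φ : Matrix ι ι ℂ →ₗ[ℂ] Matrix ι ι ℂ) (K : Matrix κ κ ℂ)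
    (X : Matrix (ι × κ) (ι × κ) ℂ) :
    amplify κ Φ (((1 : Matrix ι ι ℂ) ⊗ₖ K) * X) = ((1 : Matrix ι ι ℂ) ⊗ₖ K) * amplify κ Φ X := by
  ext p q
  have h : (Matrix.of fun i j => (((1 : Matrix ι ι ℂ) ⊗ₖ K) * X) (i, p.2) (j, q.2)) =
      ∑ l, K p.2 l • Matrix.of fun i j => X (i, l) (j, q.2) := by
    ext i j
    simp [Matrix.mul_apply, Fintype.sum_prod_type, Matrix.one_apply, Matrix.sum_apply]
  simp only [amplify, LinearMap.coe_mk, AddHom.coe_mk, Matrix.of_apply, h, map_sum, map_smul]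
  simp [Matrix.mul_apply, Fintype.sum_prod_type, Matrix.one_apply, Matrix.sum_apply]

theorem amplify_mul_kronecker (Φ : Matrix ι ι ℂ →ₗ[ℂ] Matrix ι ι ℂ) (K : Matrix κ κ ℂ)
    (X : Matrix (ι × κ) (ι × κ) ℂ) :
    amplify κ Φ (X * ((1 : Matrix ι ι ℂ) ⊗ₖ K)) = amplify κ Φ X * ((1 : Matrix ι ι ℂ) ⊗ₖ K) := by
  ext p q
  have h : (Matrix.of fun i j => (X * ((1 : Matrix ι ι ℂ) ⊗ₖ K)) (i, p.2) (j, q.2)) =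
      ∑ l, K l q.2 • Matrix.of fun i j => X (i, p.2) (j, l) := by
    ext i j
    simp [Matrix.mul_apply, Fintype.sum_prod_type, Matrix.one_apply, Matrix.sum_apply, mul_comm]
  simp only [amplify, LinearMap.coe_mk, AddHom.coe_mk, Matrix.of_apply, h, map_sum, map_smul]
  simp [Matrix.mul_apply, Fintype.sum_prod_type, Matrix.one_apply, Matrix.sum_apply, mul_comm]

theorem IsQChannel.amplify_pos {Φ : Matrix ι ι ℂ →ₗ[ℂ] Matrix ι ι ℂ} (hΦ : IsQChannel Φ)
    {X : Matrix (ι × κ) (ι × κ) ℂ} (hX : X.PosSemidef) : (amplify κ Φ X).PosSemidef := by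
  -- Complete positivity is stated for ancillas `Fin n`; a relabelling transfers it to `κ`.
  let e := Fintype.equivFin κ
  let f : ι × κ → ι × Fin (Fintype.card κ) := fun p => (p.1, e p.2)
  have h := (hΦ.completelyPositive _ (X.submatrix (fun p => (p.1, e.symm p.2))
    fun p => (p.1, e.symm p.2)) (hX.submatrix _)).submatrix f
  convert h using 1
  ext p q
  simp [amplify, f]

theorem IsQChannel.trace_amplify {Φ : Matrix ι ι ℂ →ₗ[ℂ] Matrix ι ι ℂ} (hΦ : IsQChannel Φ)
    (X : Matrix (ι × κ) (ι × κ) ℂ) : (amplify κ Φ X).trace = X.trace := by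
  simp only [Matrix.trace, Fintype.sum_prod_type_right, Matrix.diag_apply]
  refine Finset.sum_congr rfl fun k _ => ?_
  exact hΦ.tracePreserving (Matrix.of fun i j => X (i, k) (j, k))

/-- The map `X ↦ tr[X] τ`. -/
noncomputable def replaceMap (τ : Matrix ι ι ℂ) : Matrix ι ι ℂ →ₗ[ℂ] Matrix ι ι ℂ :=
  (Matrix.traceLinearMap ι ℂ ℂ).smulRight τ

theorem amplify_replaceMap (τ : Matrix ι ι ℂ) (X : Matrix (ι × κ) (ι × κ) ℂ) :
    amplify κ (replaceMap τ) X =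
      τ ⊗ₖ (Matrix.of fun k l => ∑ i, X (i, k) (i, l)) := by
  ext p q
  simp [amplify, replaceMap, Matrix.trace, mul_comm]

theorem isQChannel_replaceMap {τ : Matrix ι ι ℂ} (hτ : IsQState τ) :
    IsQChannel (replaceMap τ) := by
  refine ⟨fun n X hX => ?_, fun X => by simp [replaceMap, hτ.2]⟩
  rw [amplify_replaceMap]
  refine hτ.1.kronecker ?_
  have h : (Matrix.of fun k l => ∑ i, X (i, k) (i, l)) =
      ∑ i, X.submatrix (fun k : Fin n => (i, k)) (fun k => (i, k)) := by
    ext k l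
    simp [Matrix.sum_apply]
  rw [h]
  exact Matrix.posSemidef_sum _ fun i _ => hX.submatrix _

end Amplify

/-! ### Partial traces, operators trivial on a subsystem, depolarization -/

section Subsystem

variable {V : Type*} [Fintype V] [DecidableEq V] {d : ℕ}

theorem tensorOne_mul_extendMap (A : Finset V)
    (Φ : QOp {v // v ∈ A} d →ₗ[ℂ] QOp {v // v ∈ A} d) (K : QOp {v // v ∉ A} d) (X : QOp V d) :
    extendMap A Φ (tensorOne A K * X) = tensorOne A K * extendMap A Φ X := by
  have h := amplify_kronecker_mul Φ K (Matrix.reindex (splitBasis A d) (splitBasis A d) X)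
  have h2 : Matrix.reindex (splitBasis A d) (splitBasis A d) (tensorOne A K * X) =
      ((1 : QOp {v // v ∈ A} d) ⊗ₖ K) * Matrix.reindex (splitBasis A d) (splitBasis A d) X := by
    simp [tensorOne, ← Matrix.submatrix_mul_equiv _ _ _ (splitBasis A d).symm]
  simp only [extendMap, LinearMap.comp_apply, LinearEquiv.coe_coe,
    Matrix.coe_reindexLinearEquiv, h2, h, Matrix.symm_reindexLinearEquiv]
  rw [Matrix.reindex_apply,
    ← Matrix.submatrix_mul_equiv _ _ _ (splitBasis A d)]
  rfl

theorem extendMap_mul_tensorOne (A : Finset V)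
    (Φ : QOp {v // v ∈ A} d →ₗ[ℂ] QOp {v // v ∈ A} d) (K : QOp {v // v ∉ A} d) (X : QOp V d) :
    extendMap A Φ (X * tensorOne A K) = extendMap A Φ X * tensorOne A K := by
  have h := amplify_mul_kronecker Φ K (Matrix.reindex (splitBasis A d) (splitBasis A d) X)
  have h2 : Matrix.reindex (splitBasis A d) (splitBasis A d) (X * tensorOne A K) =
      Matrix.reindex (splitBasis A d) (splitBasis A d) X * ((1 : QOp {v // v ∈ A} d) ⊗ₖ K) := by
    simp [tensorOne, ← Matrix.submatrix_mul_equiv _ _ _ (splitBasis A d).symm]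
  simp only [extendMap, LinearMap.comp_apply, LinearEquiv.coe_coe,
    Matrix.coe_reindexLinearEquiv, h2, h, Matrix.symm_reindexLinearEquiv]
  rw [Matrix.reindex_apply,
    ← Matrix.submatrix_mul_equiv _ _ _ (splitBasis A d)]
  rfl

theorem isPTP_extendMap {A : Finset V} {Φ : QOp {v // v ∈ A} d →ₗ[ℂ] QOp {v // v ∈ A} d}
    (hΦ : IsQChannel Φ) : IsPTP (extendMap A Φ) := by
  refine ⟨fun X hX => ?_, fun X => ?_⟩
  · exact (hΦ.amplify_pos (hX.submatrix (splitBasis A d).symm)).submatrix (splitBasis A d)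
  · have h := hΦ.trace_amplify (Matrix.reindex (splitBasis A d) (splitBasis A d) X)
    have e : ∀ {α β : Type _} [Fintype α] [Fintype β] (e : α ≃ β) (M : Matrix α α ℂ),
        (Matrix.reindex e e M).trace = M.trace := fun e M => by
      simp only [Matrix.trace]
      exact e.symm.sum_comp fun i => M i i
    rw [e] at h
    refine Eq.trans ?_ h
    exact e (splitBasis A d).symm _

theorem trace_tensorOne_mul (A : Finset V) (K : QOp {v // v ∉ A} d) (X : QOp V d) :
    (tensorOne A K * X).trace = (K * partialTrace A X).trace := by
  simp only [Matrix.trace, Matrix.diag_apply, Matrix.mul_apply]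
  rw [← (splitBasis A d).symm.sum_comp]
  simp_rw [← (splitBasis A d).symm.sum_comp (fun y => tensorOne A K _ y * X y _)]
  simp only [Fintype.sum_prod_type, tensorOne, partialTrace]
  simp [Matrix.one_apply, Finset.mul_sum]
  rw [Finset.sum_comm]
  refine Finset.sum_congr rfl fun x _ => ?_
  rw [Finset.sum_comm]

theorem partialTrace_tensorOne (A : Finset V) (K : QOp {v // v ∉ A} d) :
    partialTrace A (tensorOne A K) = ((d : ℂ) ^ A.card) • K := by
  ext x y
  simp [partialTrace, tensorOne]

theorem partialTrace_conjTranspose (A : Finset V) (X : QOp V d) :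
    partialTrace A Xᴴ = (partialTrace A X)ᴴ := by
  ext x y
  simp [partialTrace]

theorem partialTrace_add (A : Finset V) (X Y : QOp V d) :
    partialTrace A (X + Y) = partialTrace A X + partialTrace A Y := by
  ext x y
  simp [partialTrace, Finset.sum_add_distrib]

theorem partialTrace_smul (A : Finset V) (c : ℂ) (X : QOp V d) :
    partialTrace A (c • X) = c • partialTrace A X := by
  ext x y
  simp [partialTrace, Finset.mul_sum]

theorem tensorOne_smul (A : Finset V) (c : ℂ) (K : QOp {v // v ∉ A} d) :
    tensorOne A (c • K) = c • tensorOne A K := by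
  ext x y
  simp [tensorOne, mul_left_comm]

theorem extendMap_replaceMap (A : Finset V) (τ : QOp {v // v ∈ A} d) (X : QOp V d) :
    extendMap A (replaceMap τ) X =
      Matrix.reindex (splitBasis A d).symm (splitBasis A d).symm (τ ⊗ₖ partialTrace A X) := by
  simp only [extendMap, LinearMap.comp_apply, LinearEquiv.coe_coe,
    Matrix.coe_reindexLinearEquiv, amplify_replaceMap, Matrix.symm_reindexLinearEquiv]
  rfl

/-- The operator `Y` acts as the identity on the qudits in `A`. -/
def TrivialOn (A : Finset V) (Y : QOp V d) : Prop :=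
  ∃ K, Y = tensorOne A K

theorem tensorOne_apply (A : Finset V) (K : QOp {v // v ∉ A} d) (x y : V → Fin d) :
    tensorOne A K x y =
      if ∀ v ∈ A, x v = y v then K (fun v => x v.1) (fun v => y v.1) else 0 := by
  have h : tensorOne A K x y = (1 : QOp {v // v ∈ A} d) (fun v => x v.1) (fun v => y v.1) *
    K (fun v => x v.1) (fun v => y v.1) := rfl
  rw [h, Matrix.one_apply]
  simp [funext_iff]

theorem TrivialOn.apply_eq_zero {A : Finset V} {Y : QOp V d} (hY : TrivialOn A Y)
    {x y : V → Fin d} {v : V} (hv : v ∈ A) (hxy : x v ≠ y v) : Y x y = 0 := by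
  obtain ⟨K, rfl⟩ := hY
  rw [tensorOne_apply, if_neg fun h => hxy (h v hv)]

theorem TrivialOn.apply_congr {A : Finset V} {Y : QOp V d} (hY : TrivialOn A Y)
    {x y x' y' : V → Fin d} (h : ∀ v ∈ A, x v = y v) (h' : ∀ v ∈ A, x' v = y' v)
    (hx : ∀ v ∉ A, x v = x' v) (hy : ∀ v ∉ A, y v = y' v) : Y x y = Y x' y' := by
  obtain ⟨K, rfl⟩ := hY
  rw [tensorOne_apply, tensorOne_apply, if_pos h, if_pos h']
  congr 1
  · ext v; rw [hx v.1 v.2]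
  · ext v; rw [hy v.1 v.2]

theorem TrivialOn.union [NeZero d] {A B : Finset V} {Y : QOp V d} (hA : TrivialOn A Y)
    (hB : TrivialOn B Y) : TrivialOn (A ∪ B) Y := by
  let f : ({v // v ∉ A ∪ B} → Fin d) → V → Fin d := fun p v =>
    if h : v ∉ A ∪ B then p ⟨v, h⟩ else 0
  refine ⟨Matrix.of fun p q => Y (f p) (f q), ?_⟩
  ext x y
  rw [tensorOne_apply]
  split_ifs with h
  · simp only [Finset.mem_union] at h
    -- Labels that agree on `A ∪ B` are set to the default `0` first on `A`, using triviality there,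
    -- and then on `B`.
    let z : (V → Fin d) → V → Fin d := fun x v => if v ∈ A then 0 else x v
    rw [hA.apply_congr (x' := z x) (y' := z y) (fun v hv => h v (.inl hv))
      (fun v hv => by simp [z, hv]) (fun v hv => by simp [z, hv]) (fun v hv => by simp [z, hv])]
    refine hB.apply_congr (fun v hv => ?_) (fun v hv => ?_) (fun v hv => ?_) (fun v hv => ?_)
    · by_cases hv' : v ∈ A <;> simp [z, hv', h v (.inr hv)]
    · simp [f, hv]
    all_goals by_cases hv' : v ∈ A <;> simp [z, f, hv', hv]
  · push Not at h
    obtain ⟨v, hv, hne⟩ := h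
    rcases Finset.mem_union.1 hv with hv | hv
    · exact hA.apply_eq_zero hv hne
    · exact hB.apply_eq_zero hv hne

theorem trivialOn_empty (Y : QOp V d) : TrivialOn ∅ Y := by
  refine ⟨Matrix.of fun p q => Y (fun v => p ⟨v, by simp⟩) (fun v => q ⟨v, by simp⟩), ?_⟩
  ext x y
  simp [tensorOne_apply]

theorem trivialOn_of_forall_singleton [NeZero d] {Y : QOp V d} (A : Finset V)
    (h : ∀ v ∈ A, TrivialOn {v} Y) : TrivialOn A Y := by
  induction A using Finset.induction_on with
  | empty => exact trivialOn_empty Y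
  | insert v A hv ih =>
    rw [Finset.insert_eq]
    exact (h v (by simp)).union (ih fun w hw => h w (by simp [hw]))

theorem TrivialOn.eq_smul_one [NeZero d] {Y : QOp V d} (h : TrivialOn Finset.univ Y) :
    ∃ c : ℂ, Y = c • 1 := by
  refine ⟨Y 0 0, ?_⟩
  ext x y
  by_cases hxy : x = y
  · subst hxy
    simpa using h.apply_congr (x := x) (y := x) (x' := 0) (y' := 0) (by simp) (by simp) (by simp)
      (by simp)
  · obtain ⟨v, hv⟩ := Function.ne_iff.1 hxy
    simp [h.apply_eq_zero (Finset.mem_univ v) hv, hxy]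

/-- The map replacing the state of the qudits in `A` by the maximally mixed one. -/
noncomputable def depolarize (A : Finset V) : Module.End ℂ (QOp V d) :=
  extendMap A (replaceMap ((((d : ℂ) ^ A.card)⁻¹) • 1))

theorem depolarize_apply (A : Finset V) (X : QOp V d) :
    depolarize A X = ((d : ℂ) ^ A.card)⁻¹ • tensorOne A (partialTrace A X) := by
  rw [depolarize, extendMap_replaceMap]
  ext x y
  simp [tensorOne, mul_assoc]

theorem trivialOn_depolarize (A : Finset V) (X : QOp V d) : TrivialOn A (depolarize A X) :=
  ⟨((d : ℂ) ^ A.card)⁻¹ • partialTrace A X, by rw [depolarize_apply, tensorOne_smul]⟩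

theorem TrivialOn.depolarize_eq [NeZero d] {A : Finset V} {Y : QOp V d} (h : TrivialOn A Y) :
    depolarize A Y = Y := by
  obtain ⟨K, rfl⟩ := h
  have : (d : ℂ) ^ A.card ≠ 0 := pow_ne_zero _ (NeZero.ne _)
  rw [depolarize_apply, partialTrace_tensorOne, tensorOne_smul, smul_smul, inv_mul_cancel₀ this,
    one_smul]

theorem trace_depolarize_mul (A : Finset V) (X Y : QOp V d) :
    (depolarize A X * Y).trace = (X * depolarize A Y).trace := by
  rw [Matrix.trace_mul_comm X]
  simp only [depolarize_apply, Matrix.smul_mul, Matrix.trace_smul, trace_tensorOne_mul]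
  rw [Matrix.trace_mul_comm]

theorem isPTP_depolarize [NeZero d] (A : Finset V) :
    IsPTP (depolarize A : Module.End ℂ (QOp V d)) := by
  refine isPTP_extendMap (isQChannel_replaceMap ⟨Matrix.PosSemidef.one.smul ?_, ?_⟩)
  · have : (0 : ℂ) ≤ d := by exact_mod_cast Nat.zero_le d
    positivity
  · have : (d : ℂ) ^ A.card ≠ 0 := pow_ne_zero _ (NeZero.ne _)
    simp [this]

theorem trivialOn_one (A : Finset V) : TrivialOn A (1 : QOp V d) := by
  refine ⟨1, ?_⟩
  simp [tensorOne]

/-- The operators orthogonal to the kernel of `tr_A` act trivially on `A`. -/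
theorem trivialOn_of_trace_eq_zero [NeZero d] {A : Finset V} {Y : QOp V d}
    (h : ∀ X : QOp V d, X.IsHermitian → partialTrace A X = 0 → (Y * X).trace = 0) :
    TrivialOn A Y := by
  have h1 : ∀ X : QOp V d, partialTrace A X = 0 → (Y * X).trace = 0 := by
    intro X hX
    have hX' : partialTrace A Xᴴ = 0 := by rw [partialTrace_conjTranspose, hX]; simp
    -- The hypothesis covers Hermitian test operators only; those built from `X` and `iX` together
    -- recover `tr[YX]` for arbitrary `X`.
    have e1 := h (X + Xᴴ) (Matrix.isHermitian_add_transpose_self X)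
      (by rw [partialTrace_add, hX, hX', add_zero])
    have e2 := h (Complex.I • X + (Complex.I • X)ᴴ) (Matrix.isHermitian_add_transpose_self _)
      (by rw [partialTrace_add, Matrix.conjTranspose_smul, partialTrace_smul, partialTrace_smul,
        hX, hX']; simp)
    simp [Matrix.mul_add] at e1 e2
    have : Complex.I * (2 * (Y * X).trace) = 0 := by linear_combination e2 + Complex.I * e1
    simpa using this
  -- Depolarization is self-adjoint for the trace pairing, and `X - depolarize A X` lies in the
  -- kernel of `tr_A`.
  have h2 : Y = depolarize A Y := by
    rw [Matrix.ext_iff_trace_mul_right]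
    intro X
    rw [trace_depolarize_mul, ← sub_eq_zero, ← Matrix.trace_sub, ← Matrix.mul_sub]
    refine h1 _ ?_
    have : (d : ℂ) ^ A.card ≠ 0 := pow_ne_zero _ (NeZero.ne _)
    rw [sub_eq_add_neg, ← neg_one_smul ℂ, partialTrace_add, partialTrace_smul, depolarize_apply,
      partialTrace_smul, partialTrace_tensorOne, smul_smul, smul_smul, mul_assoc, inv_mul_cancel₀ this]
    simp
  rw [h2]
  exact trivialOn_depolarize A Y

theorem TrivialOn.depolarize_of_disjoint [NeZero d] {A B : Finset V} (hAB : Disjoint A B) {Y : QOp V d}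
    (h : TrivialOn A Y) : TrivialOn A (depolarize B Y) := by
  have e : depolarize B (depolarize A Y) = depolarize A (depolarize B Y) :=
    LinearMap.congr_fun (extendMap_commute hAB.symm _ _) Y
  rw [← h.depolarize_eq, e]
  exact trivialOn_depolarize A _

end Subsystem

/-! ### Second-moment growth under one gate and under one layer -/

section Gates

variable {V : Type*} [Fintype V] [DecidableEq V] {d : ℕ}

theorem TrivialOn.heisenberg_mul_right {A : Finset V} {K : QOp V d} (hK : TrivialOn A K)
    (Φ : QOp {v // v ∈ A} d →ₗ[ℂ] QOp {v // v ∈ A} d) (X : QOp V d) :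
    heisenberg (extendMap A Φ) (X * K) = heisenberg (extendMap A Φ) X * K := by
  obtain ⟨K, rfl⟩ := hK
  rw [Matrix.ext_iff_trace_mul_right]
  intro Z
  rw [trace_heisenberg_mul, Matrix.mul_assoc, Matrix.mul_assoc, trace_heisenberg_mul,
    tensorOne_mul_extendMap]

theorem TrivialOn.heisenberg_mul_left {A : Finset V} {K : QOp V d} (hK : TrivialOn A K)
    (Φ : QOp {v // v ∈ A} d →ₗ[ℂ] QOp {v // v ∈ A} d) (X : QOp V d) :
    heisenberg (extendMap A Φ) (K * X) = K * heisenberg (extendMap A Φ) X := by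
  obtain ⟨K, rfl⟩ := hK
  rw [Matrix.ext_iff_trace_mul_right]
  intro Z
  rw [trace_heisenberg_mul, Matrix.trace_mul_comm, ← Matrix.mul_assoc, Matrix.trace_mul_comm,
    ← extendMap_mul_tensorOne, ← trace_heisenberg_mul, Matrix.mul_assoc,
    Matrix.trace_mul_comm (tensorOne A K), ← Matrix.mul_assoc]

theorem TrivialOn.heisenberg_eq {A : Finset V} {K : QOp V d} (hK : TrivialOn A K)
    {Φ : QOp {v // v ∈ A} d →ₗ[ℂ] QOp {v // v ∈ A} d} (hΦ : IsQChannel Φ) :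
    heisenberg (extendMap A Φ) K = K := by
  have := hK.heisenberg_mul_right Φ 1
  rwa [(isPTP_extendMap hΦ).heisenberg_one, one_mul] at this

/-- Triviality on `A` means being fixed by `depolarize A`, and duality carries the commutation over
to `heisenberg T`. This lets the other gates of a layer pass. -/
theorem TrivialOn.heisenberg_of_commute [NeZero d] {A : Finset V} {Y : QOp V d}
    (hY : TrivialOn A Y) {T : Module.End ℂ (QOp V d)} (hT : Commute T (depolarize A)) :
    TrivialOn A (heisenberg T Y) := by
  have h : heisenberg T Y = depolarize A (heisenberg T Y) := by
    rw [Matrix.ext_iff_trace_mul_right]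
    intro X
    rw [trace_depolarize_mul, trace_heisenberg_mul, trace_heisenberg_mul]
    have e : T (depolarize A X) = depolarize A (T X) := LinearMap.congr_fun hT.eq X
    rw [e, ← trace_depolarize_mul, hY.depolarize_eq]
  rw [h]
  exact trivialOn_depolarize A _

theorem OpBound.heisenberg {ι : Type*} [Fintype ι] [DecidableEq ι] {H : Matrix ι ι ℂ} {r : ℝ}
    (h : OpBound H r) {Φ : Module.End ℂ (Matrix ι ι ℂ)} (hΦ : IsPTP Φ) :
    OpBound (heisenberg Φ H) r :=
  h.map (fun _ hX => hΦ.heisenberg_pos hX) hΦ.heisenberg_one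

theorem Matrix.IsHermitian.trace_mul_sq_nonneg {ι : Type*} [Fintype ι] [DecidableEq ι]
    {H σ : Matrix ι ι ℂ} (hH : H.IsHermitian) (hσ : IsQState σ) :
    0 ≤ (σ * (H * H)).trace.re := by
  have h := Matrix.posSemidef_conjTranspose_mul_self H
  rw [hH.eq] at h
  exact (Complex.nonneg_iff.1 (hσ.1.trace_mul_nonneg h)).1

/-- How much a single gate increases the second moment of an observable which is close to one
acting trivially on the qudits of the gate. -/
theorem extendMap_second_moment_le {A : Finset V}
    {Φ : QOp {v // v ∈ A} d →ₗ[ℂ] QOp {v // v ∈ A} d} (hΦ : IsQChannel Φ) {σ : QOp V d}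
    (hσ : IsQState σ) {G K : QOp V d} {r : ℝ} (hK : TrivialOn A K) (hGK : OpBound (G - K) r) :
    (extendMap A Φ σ * (G * G)).trace.re ≤
      (σ * (heisenberg (extendMap A Φ) G * heisenberg (extendMap A Φ) G)).trace.re + r ^ 2 := by
  have hT := isPTP_extendMap (V := V) hΦ
  obtain ⟨D, rfl⟩ : ∃ D, G = D + K := ⟨G - K, by simp⟩
  rw [add_sub_cancel_right] at hGK
  have h1 := hGK.trace_sq_le (hT.isQState hσ)
  have h2 := (hGK.heisenberg hT).isHermitian.trace_mul_sq_nonneg hσ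
  have e : ∀ X : QOp V d, (extendMap A Φ σ * X).trace =
      (σ * heisenberg (extendMap A Φ) X).trace := fun X => by
    rw [Matrix.trace_mul_comm, ← trace_heisenberg_mul, Matrix.trace_mul_comm]
  -- The bracket is carried by the dual map to the corresponding bracket for the image of `D`, so it
  -- cancels from the two second moments.
  have e1 : (D + K) * (D + K) = D * D + (D * K + K * D + K * K) := by
    rw [add_mul, mul_add, mul_add]; abel
  have e2 : heisenberg (extendMap A Φ) (D * K + K * D + K * K) =
      heisenberg (extendMap A Φ) D * K + K * heisenberg (extendMap A Φ) D + K * K := by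
    rw [map_add, map_add, hK.heisenberg_mul_right, hK.heisenberg_mul_left,
      hK.heisenberg_mul_right, hK.heisenberg_eq hΦ]
  have e3 : heisenberg (extendMap A Φ) (D + K) * heisenberg (extendMap A Φ) (D + K) =
      heisenberg (extendMap A Φ) D * heisenberg (extendMap A Φ) D +
      (heisenberg (extendMap A Φ) D * K + K * heisenberg (extendMap A Φ) D + K * K) := by
    rw [map_add, hK.heisenberg_eq hΦ, add_mul, mul_add, mul_add]; abel
  rw [e1, Matrix.mul_add, Matrix.trace_add, e (_ + _ + _), e2, e3, Matrix.mul_add σ (_ * _),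
    Matrix.trace_add, Complex.add_re, Complex.add_re]
  linarith

theorem isPTP_noncommProd {F : Finset (Finset V)}
    {N : (e : Finset V) → QOp {v // v ∈ e} d →ₗ[ℂ] QOp {v // v ∈ e} d}
    (comm) (hN : ∀ e ∈ F, IsQChannel (N e)) :
    IsPTP (F.noncommProd (fun e => (extendMap e (N e) : Module.End ℂ (QOp V d))) comm) :=
  Finset.noncommProd_induction F _ comm IsPTP (fun _ _ h h' => h.comp h') IsPTP.id
    fun e he => isPTP_extendMap (hN e he)

/-- Gate-by-gate telescoping. The induction varies `σ`, because the remaining gates see the state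
already processed by the removed one. -/
theorem noncommProd_second_moment_le [NeZero d] {F : Finset (Finset V)}
    {N : (e : Finset V) → QOp {v // v ∈ e} d →ₗ[ℂ] QOp {v // v ∈ e} d}
    (comm) (hF : (F : Set (Finset V)).PairwiseDisjoint id) (hN : ∀ e ∈ F, IsQChannel (N e))
    {σ : QOp V d} (hσ : IsQState σ) {G : QOp V d} {r : ℝ}
    (hG : ∀ e ∈ F, ∃ K, TrivialOn e K ∧ OpBound (G - K) r) :
    (F.noncommProd (fun e => (extendMap e (N e) : Module.End ℂ (QOp V d))) comm σ *
        (G * G)).trace.re ≤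
      (σ * (heisenberg (F.noncommProd (fun e => extendMap e (N e)) comm) G *
        heisenberg (F.noncommProd (fun e => extendMap e (N e)) comm) G)).trace.re +
        F.card * r ^ 2 := by
  induction F using Finset.induction_on generalizing σ with
  | empty =>
    have : heisenberg (1 : Module.End ℂ (QOp V d)) G = G := heisenberg_id G
    simp [this]
  | insert e F he ih =>
    have comm' : (F : Set (Finset V)).Pairwise
        (Function.onFun Commute fun e => (extendMap e (N e) : Module.End ℂ (QOp V d))) :=
      comm.mono (by simp)
    have hN' : ∀ f ∈ F, IsQChannel (N f) := fun f hf => hN f (by simp [hf])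
    set T := F.noncommProd (fun e => (extendMap e (N e) : Module.End ℂ (QOp V d))) comm' with hT
    have hins : (insert e F).noncommProd
        (fun e => (extendMap e (N e) : Module.End ℂ (QOp V d))) comm =
        T ∘ₗ extendMap e (N e) :=
      Finset.noncommProd_insert_of_notMem' _ _ _ _ he
    have hcomm : Commute T (depolarize e) := by
      refine (Finset.noncommProd_commute _ _ _ _ fun f hf => ?_).symm
      refine extendMap_commute (hF (by simp) (by simp [hf]) ?_) _ _
      rintro rfl
      exact he hf
    have hch := hN e (by simp)
    obtain ⟨K, hK, hGK⟩ := hG e (by simp)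
    have h1 := ih comm' (hF.subset (by simp)) hN' ((isPTP_extendMap hch).isQState hσ)
      fun f hf => hG f (by simp [hf])
    -- The gate `e` acts before `T`, so it meets the observable pulled back through `T`, which is
    -- still within `r` of one trivial on `e`.
    have h2 := extendMap_second_moment_le hch hσ (G := heisenberg T G)
      (hK.heisenberg_of_commute hcomm) (r := r) (by
        rw [← map_sub]
        exact hGK.heisenberg (isPTP_noncommProd comm' hN'))
    rw [hins, heisenberg_comp, Finset.card_insert_of_notMem he]
    push_cast
    refine h1.trans ?_
    linarith

end Gates

/-! ### Light-cones and Lipschitz approximation -/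

section LightCone

variable {V : Type*} [Fintype V] [DecidableEq V] {d : ℕ}

theorem isHermitian_tensorOne {A : Finset V} {K : QOp {v // v ∉ A} d} (hK : K.IsHermitian) :
    (tensorOne A K).IsHermitian := by
  have h : ((1 : QOp {v // v ∈ A} d) ⊗ₖ K).IsHermitian := by
    rw [Matrix.IsHermitian, Matrix.conjTranspose_kronecker, hK.eq, Matrix.conjTranspose_one]
  exact h.submatrix _

/-- With `Δ` the depolarization of `v` and `K` trivial on `v`, `O - Δ(O) = (O - K) - Δ(O - K)`. The
two terms use up exactly the factor `2` in the Lipschitz constant; the `ε` replaces a minimizing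
`K`. -/
theorem opBound_sub_depolarize [NeZero d] {O : QOp V d} (hO : O.IsHermitian) (v : V) :
    OpBound (O - depolarize {v} O) (qLipschitz O) := by
  refine opBound_of_forall_pos fun ε hε => ?_
  have : Nonempty {K : QOp {w // w ∉ ({v} : Finset V)} d // K.IsHermitian} :=
    ⟨⟨0, Matrix.isHermitian_zero⟩⟩
  obtain ⟨⟨K, hK⟩, hlt⟩ := exists_lt_of_ciInf_lt (lt_add_of_pos_right
    (⨅ K : {K : QOp {w // w ∉ ({v} : Finset V)} d // K.IsHermitian},
      qOpNorm (O - tensorOne {v} K.1)) (half_pos hε))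
  have hle := le_ciSup (f := fun v : V =>
    ⨅ K : {K : QOp {w // w ∉ ({v} : Finset V)} d // K.IsHermitian},
      qOpNorm (O - tensorOne {v} K.1)) (Set.finite_range _).bddAbove v
  have hb := opBound_qOpNorm (hO.sub (isHermitian_tensorOne hK))
  have hp := isPTP_depolarize (V := V) (d := d) {v}
  have hdep := hb.map hp.pos (trivialOn_one {v}).depolarize_eq
  have hs := hb.sub hdep
  rw [map_sub, TrivialOn.depolarize_eq ⟨K, rfl⟩, sub_sub_sub_cancel_right] at hs
  refine hs.mono ?_
  simp only [qLipschitz]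
  linarith

theorem exists_trivialOn_opBound_card [NeZero d] {O : QOp V d} (hO : O.IsHermitian)
    (S : Finset V) : ∃ K, TrivialOn S K ∧ OpBound (O - K) (S.card * qLipschitz O) := by
  induction S using Finset.induction_on with
  | empty => exact ⟨O, trivialOn_empty O, by simpa using opBound_zero⟩
  | insert v S hv ih =>
    obtain ⟨K, hK, hb⟩ := ih
    refine ⟨depolarize {v} K, ?_, ?_⟩
    · rw [Finset.insert_eq]
      exact (trivialOn_depolarize _ _).union (hK.depolarize_of_disjoint (by simpa using hv))
    · have h1 := hb.map (isPTP_depolarize {v}).pos (trivialOn_one {v}).depolarize_eq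
      have h2 := (opBound_sub_depolarize hO v).add h1
      -- With `Δ` the depolarization of `v`: `O - Δ(K) = (O - Δ(O)) + Δ(O - K)`, so each qudit adds
      -- one Lipschitz constant.
      rw [map_sub, sub_add_sub_cancel] at h2
      refine h2.mono (le_of_eq ?_)
      rw [Finset.card_insert_of_notMem hv]
      push_cast
      ring

/-- Confinement dualizes: the pullback of an operator trivial on `S` annihilates the Hermitian
kernel of `tr_A`, hence is trivial on `A`. -/
theorem ConfinesInfluence.exists_trivialOn [NeZero d] {Φ : Module.End ℂ (QOp V d)}
    (hΦ : IsPTP Φ) {A S : Finset V} (h : ConfinesInfluence Φ A S) {O : QOp V d}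
    (hO : O.IsHermitian) :
    ∃ Y, TrivialOn A Y ∧ OpBound (heisenberg Φ O - Y) (S.card * qLipschitz O) := by
  obtain ⟨K, ⟨K', rfl⟩, hb⟩ := exists_trivialOn_opBound_card hO S
  refine ⟨heisenberg Φ (tensorOne S K'), trivialOn_of_trace_eq_zero fun X hX hX0 => ?_, ?_⟩
  · rw [trace_heisenberg_mul, trace_tensorOne_mul, h X hX hX0]
    simp
  · rw [← map_sub]
    exact hb.heisenberg hΦ

theorem trace_partialTrace (A : Finset V) (X : QOp V d) :
    (partialTrace A X).trace = X.trace := by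
  have h := trace_tensorOne_mul A 1 X
  rw [one_mul] at h
  rw [← h]
  simp [tensorOne]

/-- Ensures that the infimum defining `lightConeSize` is attained and is not the default `0` of an
empty set. -/
theorem confinesInfluence_univ {Φ : Module.End ℂ (QOp V d)} (hΦ : IsPTP Φ) (A : Finset V) :
    ConfinesInfluence Φ A Finset.univ := by
  intro O _ h0
  have h1 : (partialTrace Finset.univ (Φ O)).trace = 0 := by
    rw [trace_partialTrace, hΦ.trace, ← trace_partialTrace A, h0, Matrix.trace_zero]
  have : IsEmpty {v : V // v ∉ (Finset.univ : Finset V)} := ⟨fun v => v.2 (Finset.mem_univ _)⟩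
  ext x y
  rw [Matrix.trace, Fintype.sum_eq_single x fun z hz => (hz (Subsingleton.elim _ _)).elim] at h1
  rw [Subsingleton.elim y x]
  exact h1

theorem exists_trivialOn_lightConeSize [NeZero d] {Φ : Module.End ℂ (QOp V d)}
    (hΦ : IsPTP Φ) (A : Finset V) {O : QOp V d} (hO : O.IsHermitian) :
    ∃ Y, TrivialOn A Y ∧ OpBound (heisenberg Φ O - Y) (lightConeSize Φ A * qLipschitz O) := by
  obtain ⟨S, hS, hc⟩ := Nat.sInf_mem (s := {k | ∃ S : Finset V, S.card = k ∧
    ConfinesInfluence Φ A S}) ⟨_, Finset.univ, rfl, confinesInfluence_univ hΦ A⟩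
  have := hc.exists_trivialOn hΦ hO
  rwa [hS] at this

end LightCone

/-! ### Hermitian expectations and nondegeneracy of the variance -/

section Variance

variable {ι : Type*} [Fintype ι] [DecidableEq ι]

theorem Matrix.IsHermitian.heisenberg {H : Matrix ι ι ℂ} (hH : H.IsHermitian)
    {Φ : Module.End ℂ (Matrix ι ι ℂ)} (hΦ : IsPTP Φ) : (heisenberg Φ H).IsHermitian :=
  ((opBound_qOpNorm hH).heisenberg hΦ).isHermitian

theorem Matrix.IsHermitian.trace_mul_conj {σ O : Matrix ι ι ℂ} (hσ : σ.IsHermitian)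
    (hO : O.IsHermitian) : star (σ * O).trace = (σ * O).trace := by
  rw [← Matrix.trace_conjTranspose, Matrix.conjTranspose_mul, hσ.eq, hO.eq, Matrix.trace_mul_comm]

theorem Matrix.IsHermitian.trace_mul_im {σ O : Matrix ι ι ℂ} (hσ : σ.IsHermitian)
    (hO : O.IsHermitian) : (σ * O).trace.im = 0 :=
  Complex.conj_eq_iff_im.1 (hσ.trace_mul_conj hO)

/-- No state has zero variance in all observables. -/
theorem exists_trace_sq_lt [Nontrivial ι] {σ : Matrix ι ι ℂ} (hσ : IsQState σ) :
    ∃ O : Matrix ι ι ℂ, O.IsHermitian ∧ (σ * O).trace.re ^ 2 < (σ * (O * O)).trace.re := by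
  by_contra! h
  have hge : ∀ O : Matrix ι ι ℂ, O.IsHermitian → (σ * (O * O)).trace.re = (σ * O).trace.re ^ 2 := by
    intro O hO
    refine le_antisymm (h O hO) ?_
    have hc := (hσ.1.1.trace_mul_im hO)
    have hs : (((σ * O).trace.re : ℂ) • (1 : Matrix ι ι ℂ)).IsHermitian := by
      rw [Matrix.IsHermitian, Matrix.conjTranspose_smul]; simp
    have := (hO.sub hs).trace_mul_sq_nonneg hσ
    simp [sub_mul, mul_sub, hσ.2, hc] at this
    nlinarith
  have hE : ∀ x : ι, (Matrix.single x x (1 : ℂ)).IsHermitian := fun x => by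
    simp [Matrix.IsHermitian, Matrix.conjTranspose_single]
  have hF : ∀ x y : ι, (Matrix.single x y (1 : ℂ) + Matrix.single y x 1).IsHermitian :=
    fun x y => by simp [Matrix.IsHermitian, Matrix.conjTranspose_single, add_comm]
  -- Let `p`, `q` be the populations of `x`, `y` and `s` the mean of the flip. Zero variances give
  -- `p = p²`, `q = q²` and `(p - q)² = s² = p + q`. The flip anticommutes with `E_x - E_y`, so
  -- their sum gives `(p - q)s = 0`; hence `p + q = 0` and `p = 0`.
  have h0 : ∀ x, (σ x x).re = 0 := by
    intro x
    obtain ⟨y, hy⟩ := exists_ne x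
    have a1 := hge _ (hE x)
    have a2 := hge _ (hE y)
    have a3 := hge _ ((hE x).sub (hE y))
    have a4 := hge _ (hF x y)
    have a5 := hge _ (((hE x).sub (hE y)).add (hF x y))
    simp [add_mul, mul_add, sub_mul, mul_sub, Matrix.single_mul_single_of_ne, hy, hy.symm,
      Matrix.trace_mul_single] at a1 a2 a3 a4 a5
    nlinarith
  have h1 := congrArg Complex.re hσ.2
  simp [Matrix.trace, h0] at h1

end Variance

/-! ### Product states and the reset layer -/

section Product

variable {V : Type*} [Fintype V] [DecidableEq V] {d : ℕ}

theorem productOp_mul (A B : V → Matrix (Fin d) (Fin d) ℂ) :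
    productOp A * productOp B = productOp fun v => A v * B v := by
  ext x y
  simp [productOp, Matrix.mul_apply, Fintype.prod_sum, Finset.prod_mul_distrib]

theorem trace_productOp (A : V → Matrix (Fin d) (Fin d) ℂ) :
    (productOp A).trace = ∏ v, (A v).trace := by
  simp [productOp, Matrix.trace, Fintype.prod_sum]

open scoped MatrixOrder in
theorem isQState_productOp {ρ : V → Matrix (Fin d) (Fin d) ℂ} (hρ : ∀ v, IsQState (ρ v)) :
    IsQState (productOp ρ) := by
  refine ⟨?_, by simp [trace_productOp, (hρ _).2]⟩
  choose X hX using fun v => CStarAlgebra.nonneg_iff_eq_star_mul_self.1 (hρ v).1.nonneg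
  have h : productOp ρ = (productOp X)ᴴ * productOp X := by
    have h1 : (productOp X)ᴴ = productOp fun v => (X v)ᴴ := by
      ext x y
      simp [productOp]
    rw [h1, productOp_mul]
    exact congrArg _ (funext hX)
  rw [h]
  exact Matrix.posSemidef_conjTranspose_mul_self _

theorem extendMap_replaceMap_productOp {ρ : V → Matrix (Fin d) (Fin d) ℂ}
    (hρ : ∀ v, IsQState (ρ v)) (A : Finset V) :
    extendMap A (replaceMap (productOp fun v : {v // v ∈ A} => ρ v)) (productOp ρ) =
      productOp ρ := by
  have h : productOp ρ = Matrix.reindex (splitBasis A d).symm (splitBasis A d).symm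
      ((productOp fun v : {v // v ∈ A} => ρ v) ⊗ₖ
        productOp fun v : {v // v ∉ A} => ρ v) := by
    ext x y
    change ∏ v, ρ v (x v) (y v) = (∏ v : {v // v ∈ A}, ρ v (x v) (y v)) *
      ∏ v : {v // v ∉ A}, ρ v (x v) (y v)
    rw [← Fintype.prod_subtype_mul_prod_subtype (· ∈ A)]
    congr!
  have h2 : partialTrace A (productOp ρ) = productOp fun v : {v // v ∉ A} => ρ v := by
    ext x y
    rw [h]
    have := trace_productOp fun v : {v // v ∈ A} => ρ v
    simp only [(hρ _).2, Finset.prod_const_one] at this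
    simp [partialTrace, ← Finset.sum_mul]
    rw [Matrix.trace] at this
    simp only [Matrix.diag_apply] at this
    rw [this, one_mul]
  rw [extendMap_replaceMap, h2, ← h]

/-- The layer which prepares the state `ρ v` on each qudit `v`. -/
noncomputable def resetLayer (ρ : V → Matrix (Fin d) (Fin d) ℂ) (hρ : ∀ v, IsQState (ρ v)) :
    CircuitLayer V d where
  E := Finset.univ.image fun v => {v}
  disjoint := by
    intro e he f hf hef
    simp only [Finset.coe_image, Set.mem_image] at he hf
    obtain ⟨v, -, rfl⟩ := he
    obtain ⟨w, -, rfl⟩ := hf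
    have : v ≠ w := fun h => hef (by rw [h])
    simpa [Function.onFun] using this
  gate e := replaceMap (productOp fun v : {v // v ∈ e} => ρ v)
  isChannel _ _ := isQChannel_replaceMap (isQState_productOp fun v => hρ v)

theorem resetLayer_toMap_productOp {ρ : V → Matrix (Fin d) (Fin d) ℂ}
    (hρ : ∀ v, IsQState (ρ v)) : (resetLayer ρ hρ).toMap (productOp ρ) = productOp ρ := by
  refine Finset.noncommProd_induction _ _ _
    (fun T : Module.End ℂ (QOp V d) => T (productOp ρ) = productOp ρ) (fun S T hS hT => ?_) rfl
    fun e _ => extendMap_replaceMap_productOp hρ e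
  rw [Module.End.mul_apply, hT, hS]

theorem trivialOn_heisenberg_replaceMap [NeZero d] (A : Finset V) (τ : QOp {v // v ∈ A} d)
    (Y : QOp V d) : TrivialOn A (heisenberg (extendMap A (replaceMap τ)) Y) := by
  refine trivialOn_of_trace_eq_zero fun X _ hX => ?_
  rw [trace_heisenberg_mul, extendMap_replaceMap, hX]
  simp

/-- Since the gates commute, any one of them can act first; its dual then acts last. -/
theorem CircuitLayer.exists_toMap_eq_comp {N : CircuitLayer V d} {e : Finset V} (he : e ∈ N.E) :
    ∃ S : Module.End ℂ (QOp V d), N.toMap = S ∘ₗ extendMap e (N.gate e) :=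
  ⟨_, (Finset.noncommProd_erase_mul _ he _ _).symm⟩

theorem heisenberg_resetLayer [NeZero d] {ρ : V → Matrix (Fin d) (Fin d) ℂ}
    (hρ : ∀ v, IsQState (ρ v)) (Y : QOp V d) :
    ∃ a : ℂ, heisenberg (resetLayer ρ hρ).toMap Y = a • 1 := by
  refine (trivialOn_of_forall_singleton _ fun v _ => ?_).eq_smul_one
  have hv : {v} ∈ (resetLayer ρ hρ).E := Finset.mem_image_of_mem _ (Finset.mem_univ v)
  obtain ⟨S, hS⟩ := CircuitLayer.exists_toMap_eq_comp hv
  rw [hS, heisenberg_comp]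
  exact trivialOn_heisenberg_replaceMap {v} _ _

end Product

/-! ### Telescoping over the circuit and the variance bound -/

section Circuit

variable {V : Type*} [Fintype V] [DecidableEq V] {d : ℕ}

theorem isPTP_toMap (N : CircuitLayer V d) : IsPTP N.toMap :=
  isPTP_noncommProd _ N.isChannel

theorem isPTP_circuitMap (c : List (CircuitLayer V d)) : IsPTP (circuitMap c) := by
  induction c with
  | nil => exact IsPTP.id
  | cons N c ih => exact ih.comp (isPTP_toMap N)

theorem circuitMap_second_moment_le [NeZero d] (c : List (CircuitLayer V d)) {σ : QOp V d}
    (hσ : IsQState σ) {O : QOp V d} (hO : O.IsHermitian) :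
    (circuitMap c σ * (O * O)).trace.re ≤
      (σ * (heisenberg (circuitMap c) O * heisenberg (circuitMap c) O)).trace.re +
        (∑ l : Fin c.length, ((c.get l).E.card : ℝ) * (maxGateLightCone c l : ℝ) ^ 2) *
          qLipschitz O ^ 2 := by
  induction c generalizing σ with
  | nil => simp [circuitMap, heisenberg_id]
  | cons N c ih =>
    have h1 := ih ((isPTP_toMap N).isQState hσ)
    have hL : 0 ≤ qLipschitz O :=
      mul_nonneg zero_le_two (Real.iSup_nonneg fun v => Real.iInf_nonneg fun K => norm_nonneg _)
    -- One radius serves the whole layer: the largest light-cone among its gates times the Lipschitz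
    -- constant.
    have h2 := noncommProd_second_moment_le (fun _ he _ hf hef =>
      extendMap_commute (N.disjoint he hf hef) _ _) N.disjoint N.isChannel hσ
      (G := heisenberg (circuitMap c) O)
      (r := (N.E.sup fun e => lightConeSize (circuitMap c) e : ℕ) * qLipschitz O) fun e he => by
        obtain ⟨Y, hY, hb⟩ := exists_trivialOn_lightConeSize (isPTP_circuitMap c) e hO
        refine ⟨Y, hY, hb.mono ?_⟩
        gcongr
        exact Finset.le_sup (f := fun e => lightConeSize (circuitMap c) e) he
    rw [circuitMap, heisenberg_comp]
    have e : (∑ l : Fin (N :: c).length, (((N :: c).get l).E.card : ℝ) *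
        (maxGateLightCone (N :: c) l : ℝ) ^ 2) =
        N.E.card * ((N.E.sup fun e => lightConeSize (circuitMap c) e : ℕ) : ℝ) ^ 2 +
        ∑ l : Fin c.length, ((c.get l).E.card : ℝ) * (maxGateLightCone c l : ℝ) ^ 2 :=
      Fin.sum_univ_succ _
    rw [e, add_mul]
    change (circuitMap c (N.toMap σ) * (O * O)).trace.re ≤ _
    refine h1.trans ?_
    rw [← add_assoc]
    gcongr
    refine h2.trans (le_of_eq ?_)
    rw [mul_pow, mul_assoc]
    rfl

theorem qVariance_eq {σ O : QOp V d} (hσ : IsQState σ) (hO : O.IsHermitian) :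
    qVariance σ O = (σ * (O * O)).trace.re - (σ * O).trace.re ^ 2 := by
  have h := hσ.1.1.trace_mul_conj hO
  have him := hσ.1.1.trace_mul_im hO
  rw [qVariance, Matrix.conjTranspose_sub, Matrix.conjTranspose_smul, h, hO.eq]
  simp [sub_mul, mul_sub, hσ.2, him]
  ring

/-- The variance of an observable after a circuit acting on a product state. -/
theorem qVariance_circuitMap_le [NeZero d] (c : List (CircuitLayer V d))
    {ρ : V → Matrix (Fin d) (Fin d) ℂ} (hρ : ∀ v, IsQState (ρ v)) {O : QOp V d}
    (hO : O.IsHermitian) :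
    qVariance (circuitMap c (productOp ρ)) O ≤
      (Fintype.card V * (maxLightCone (circuitMap c) : ℝ) ^ 2 +
        ∑ l : Fin c.length, ((c.get l).E.card : ℝ) * (maxGateLightCone c l : ℝ) ^ 2) *
          qLipschitz O ^ 2 := by
  have hstate := isQState_productOp hρ
  have hout := (isPTP_circuitMap c).isQState hstate
  -- The added layer leaves the output unchanged, while the full pullback of `O` becomes the scalar
  -- `a`, the mean of `O`. Its gates are the singletons, whose light-cones under `c` define
  -- `maxLightCone`.
  have h := circuitMap_second_moment_le (resetLayer ρ hρ :: c) hstate hO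
  obtain ⟨a, ha⟩ := heisenberg_resetLayer hρ (heisenberg (circuitMap c) O)
  have hmap : circuitMap (resetLayer ρ hρ :: c) (productOp ρ) = circuitMap c (productOp ρ) :=
    congrArg (circuitMap c) (resetLayer_toMap_productOp hρ)
  have hH : heisenberg (circuitMap (resetLayer ρ hρ :: c)) O = a • 1 := by
    rw [circuitMap, heisenberg_comp, ha]
  have hmean : (circuitMap c (productOp ρ) * O).trace = a := by
    rw [← hmap, Matrix.trace_mul_comm, ← trace_heisenberg_mul, hH]
    simp [hstate.2]
  have him := hout.1.1.trace_mul_im hO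
  rw [hmean] at him
  have e : (∑ l : Fin (resetLayer ρ hρ :: c).length,
      (((resetLayer ρ hρ :: c).get l).E.card : ℝ) *
        (maxGateLightCone (resetLayer ρ hρ :: c) l : ℝ) ^ 2) =
      Fintype.card V * (maxLightCone (circuitMap c) : ℝ) ^ 2 +
        ∑ l : Fin c.length, ((c.get l).E.card : ℝ) * (maxGateLightCone c l : ℝ) ^ 2 := by
    refine (Fin.sum_univ_succ _).trans (congrArg₂ _ ?_ rfl)
    have h1 : (resetLayer ρ hρ).E.card = Fintype.card V :=
      Finset.card_image_of_injective _ Finset.singleton_injective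
    have h2 : maxGateLightCone (resetLayer ρ hρ :: c) (0 : Fin (c.length + 1)) =
        maxLightCone (circuitMap c) := Finset.sup_image _ _ _
    rw [← h1, ← h2]
    rfl
  rw [qVariance_eq hout hO, hmean, ← e]
  rw [hmap, hH] at h
  simp [hstate.2, him] at h
  simp only [List.length_cons, List.get_eq_getElem]
  linarith

end Circuit

theorem mainTheorem5 {V : Type*} [Fintype V] [DecidableEq V] [Nonempty V] {d : ℕ} (hd : 2 ≤ d)
    (c : List (CircuitLayer V d))
    (ρ : V → Matrix (Fin d) (Fin d) ℂ) (hρ : ∀ v, IsQState (ρ v)) :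
    ∃ C : ℝ,
      C ≤ 4 * ((maxLightCone (circuitMap c) : ℝ) ^ 2 +
        (maxGates c : ℝ) / (Fintype.card V : ℝ) *
          ∑ l : Fin c.length, (maxGateLightCone c l : ℝ) ^ 2) ∧
      PoincareTwoInfty (circuitMap c (productOp ρ)) C := by
  have : NeZero d := ⟨by omega⟩
  have : Nontrivial (Fin d) := Fin.nontrivial_iff_two_le.2 hd
  set B : ℝ := (maxLightCone (circuitMap c) : ℝ) ^ 2 + (maxGates c : ℝ) / (Fintype.card V : ℝ) *
    ∑ l : Fin c.length, (maxGateLightCone c l : ℝ) ^ 2 with hB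
  have hV : (0 : ℝ) < Fintype.card V := by exact_mod_cast Fintype.card_pos
  have hvar : ∀ O : QOp V d, O.IsHermitian →
      qVariance (circuitMap c (productOp ρ)) O ≤ B * Fintype.card V * qLipschitz O ^ 2 := by
    intro O hO
    refine (qVariance_circuitMap_le c hρ hO).trans ?_
    gcongr
    have e : B * Fintype.card V = Fintype.card V * (maxLightCone (circuitMap c) : ℝ) ^ 2 +
        ∑ l : Fin c.length, (maxGates c : ℝ) * (maxGateLightCone c l : ℝ) ^ 2 := by
      rw [hB, ← Finset.mul_sum]
      field_simp
    rw [e]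
    gcongr with l
    exact Finset.le_sup (f := fun l : Fin c.length => (c.get l).E.card) (Finset.mem_univ l)
  have hB0 : 0 ≤ B := by positivity
  -- The bracket `B` itself works, and the factor `4` is slack. If `B` were `0`, all variances would
  -- vanish, which is impossible in dimension at least two.
  refine ⟨B, by linarith, hB0.lt_of_ne fun h0 => ?_, hvar⟩
  have hout := (isPTP_circuitMap c).isQState (isQState_productOp hρ)
  obtain ⟨O, hO, hlt⟩ := exists_trace_sq_lt hout
  have := hvar O hO
  rw [← h0, qVariance_eq hout hO] at this
  linarith
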